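/- Let $K=\mathbb{Q}(\sqrt5)$, let $'$ be its non-trivial automorphism ($\sqrt5\mapsto-\sqrt5$), let $\tau=(1+\sqrt5)/2$ and $\mathfrak{o}=\mathbb{Z}[\tau]$. Write quaternions in $\mathbb{H}(K)\subset\mathbb{H}(\mathbb{R})=\mathbb{R}^4$ as $(a,b,c,d)=a+\mathrm{i}b+\mathrm{j}c+\mathrm{k}d$, let $|q|$ be the Euclidean length of $q$, and for $q=(a,b,c,d)\in\mathbb{H}(K)$ let $\tilde q=(a',b',d',c')$. Let $\mathbb{I}\subset\mathbb{H}(K)$ be the icosian ring, the $\mathfrak{o}$-span of $(1,0,0,0)$, $(0,1,0,0)$, $\tfrac12(1,1,1,1)$, $\tfrac12(1-\tau,\tau,0,1)$, and let $L\subset\mathbb{R}^4$ be the lattice (a copy of the root lattice $A_4$ scaled by $1/\sqrt2$) spanned over $\mathbb{Z}$ by $(1,0,0,0)$, $\tfrac12(-1,1,1,1)$, $(0,-1,0,0)$, $\tfrac12(0,1,\tau-1,-\tau)$. An icosian $p\in\mathbb{I}$ is called primitive if $\alpha p\in\mathbb{I}$ with $\alpha\in K$ implies $\alpha\in\mathfrak{o}$,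 and admissible if $|p\tilde p|\in\mathbb{N}$. For $a,b\in\mathbb{I}$, let $\operatorname{glcd}(a,b)$ be their greatest left common divisor in $\mathbb{I}$, that is, an element $d\in\mathbb{I}$ with $a,b\in d\mathbb{I}$ such that $d\in c\mathbb{I}$ for every $c\in\mathbb{I}$ with $a,b\in c\mathbb{I}$; it is determined up to right multiplication by units of $\mathbb{I}$, and equality of greatest left common divisors is understood in this sense. Let $p_1,p_2\in\mathbb{I}$ be primitive and admissible, such that $$|p_1|^2=|p_2|^2\quad\text{and}\quad \operatorname{glcd}(p_1,|p_1\tilde p_1|)=\operatorname{glcd}(p_2,|p_2\tilde p_2|).$$ Then $p_1$ and $p_2$ define the same coincidence site lattice of $L$: $$L\cap\frac{1}{|p_1\tilde p_1|}\,p_1L\tilde p_1 \;=\; L\cap\frac{1}{|p_2\tilde p_2|}\,p_2L\tilde p_2 .$$ -/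

import Mathlib

open scoped Quaternion

noncomputable section

namespace Icosian

/-- The quadratic field `ℚ(√5)`, with elements `r + s √5` for rational `r`, `s`. -/
abbrev K : Type := QuadraticAlgebra ℚ 5 0

/-- The golden ratio `(1 + √5) / 2` as an element of `ℚ(√5)`. -/
def τ : K := ⟨1 / 2, 1 / 2⟩

theorem τ_mul_τ : τ * τ = τ + 1 := by
  ext <;> simp [τ, QuadraticAlgebra.re_one, QuadraticAlgebra.im_one] <;> norm_num

/-- The algebraic conjugation `r + s √5 ↦ r - s √5` of `ℚ(√5)`. -/
def conj (α : K) : K := ⟨α.re, -α.im⟩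

/-- The real embedding of `ℚ(√5)` that sends `√5` to the positive square root of `5`. -/
def toReal : K →ₐ[ℚ] ℝ :=
  QuadraticAlgebra.lift ⟨√5, by
    rw [Real.mul_self_sqrt (by norm_num)]
    simp [Algebra.smul_def]⟩

/-- The ring `ℤ[τ] = {m + n τ | m, n ∈ ℤ}`. -/
def 𝔬 : Subring K where
  carrier := {α | ∃ m n : ℤ, α = m + n * τ}
  zero_mem' := ⟨0, 0, by simp⟩
  one_mem' := ⟨1, 0, by simp⟩
  add_mem' := by
    rintro _ _ ⟨m, n, rfl⟩ ⟨m', n', rfl⟩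
    exact ⟨m + m', n + n', by push_cast; ring⟩
  neg_mem' := by
    rintro _ ⟨m, n, rfl⟩
    exact ⟨-m, -n, by push_cast; ring⟩
  mul_mem' := by
    rintro _ _ ⟨m, n, rfl⟩ ⟨m', n', rfl⟩
    refine ⟨m * m' + n * n', m * n' + n * m' + n * n', ?_⟩
    push_cast
    linear_combination (n * n' : K) * τ_mul_τ

/-- The icosian ring: all `𝔬`-linear combinations of `(1,0,0,0)`, `(0,1,0,0)`,
`½(1,1,1,1)` and `½(1-τ,τ,0,1)` in the quaternion algebra `ℍ(K)`. -/
def 𝕀 : Submodule 𝔬 ℍ[K] :=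
  Submodule.span 𝔬
    {⟨1, 0, 0, 0⟩, ⟨0, 1, 0, 0⟩,
      (1 / 2 : ℚ) • (⟨1, 1, 1, 1⟩ : ℍ[K]),
      (1 / 2 : ℚ) • (⟨1 - τ, τ, 0, 1⟩ : ℍ[K])}

/-- The twist map `(a, b, c, d) ↦ (a', b', d', c')`. -/
def twist (q : ℍ[K]) : ℍ[K] :=
  ⟨conj q.re, conj q.imI, conj q.imK, conj q.imJ⟩

/-- The inclusion of `ℍ(K)` into the real quaternions, i.e. into Euclidean 4-space. -/
def toRealQuat (q : ℍ[K]) : ℍ[ℝ] :=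
  ⟨toReal q.re, toReal q.imI, toReal q.imJ, toReal q.imK⟩

/-- The Euclidean length `|q|`, a real number that need not lie in `K`. -/
def len (q : ℍ[K]) : ℝ := ‖toRealQuat q‖

/-- `p` is a primitive icosian: `α p ∈ 𝕀` with `α ∈ K` is only possible with `α ∈ 𝔬`. -/
def IsPrimitive (p : ℍ[K]) : Prop :=
  p ∈ 𝕀 ∧ ∀ α : K, α • p ∈ 𝕀 → α ∈ 𝔬

/-- `p` is an admissible icosian: `|p p̃|` is a natural number. -/
def IsAdmissible (p : ℍ[K]) : Prop :=
  p ∈ 𝕀 ∧ ∃ n : ℕ, len (p * twist p) = n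

/-- `d` is a left divisor of `a` in the icosian ring: `a ∈ d 𝕀`. -/
def LeftDvd (d a : ℍ[K]) : Prop :=
  ∃ x ∈ 𝕀, a = d * x

/-- The greatest left common divisors of `a` and `b` in the icosian ring. A greatest left common
divisor is only determined up to right multiplication by units of `𝕀`, so `glcd a b` is the
class of all of them. -/
def glcd (a b : ℍ[K]) : Set ℍ[K] :=
  {d | d ∈ 𝕀 ∧ LeftDvd d a ∧ LeftDvd d b ∧
    ∀ c ∈ 𝕀, LeftDvd c a → LeftDvd c b → LeftDvd c d}

/-- The lattice `L` in Euclidean 4-space (the root lattice `A₄` scaled by `1/√2`): the integer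
span of `(1,0,0,0)`, `½(-1,1,1,1)`, `(0,-1,0,0)` and `½(0,1,τ-1,-τ)`. -/
def L : AddSubgroup ℍ[ℝ] :=
  AddSubgroup.closure
    {⟨1, 0, 0, 0⟩,
      (1 / 2 : ℝ) • (⟨-1, 1, 1, 1⟩ : ℍ[ℝ]),
      ⟨0, -1, 0, 0⟩,
      (1 / 2 : ℝ) • (⟨0, 1, Real.goldenRatio - 1, -Real.goldenRatio⟩ : ℍ[ℝ])}

/-- The map `R(q) : x ↦ |q q̃|⁻¹ q x q̃` of Euclidean 4-space. -/
def R (q : ℍ[K]) : ℍ[ℝ] →ₗ[ℝ] ℍ[ℝ] :=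
  (len (q * twist q))⁻¹ •
    (LinearMap.mulLeft ℝ (toRealQuat q) ∘ₗ LinearMap.mulRight ℝ (toRealQuat (twist q)))

/-- The coincidence site lattice `L ∩ R(q) L` defined by `q`. -/
def csl (q : ℍ[K]) : AddSubgroup ℍ[ℝ] :=
  L ⊓ L.map (R q).toAddMonoidHom

end Icosian

end

/-! Write `p̄` for the quaternion conjugate `star p` and `σ z` for `twist (star z)`, which is a ring
automorphism of `𝕀`. The lattice `L` consists of the icosians `z` with `twist z = z`, and `R p̄` is
inverse to `R p`, so with `n = |p p̃|` such a `z` lies in `csl p` exactly when `n` divides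
`p̄ * z * σ p` in `𝕀`. Since `n` is central and fixed by `σ`, this condition passes from `p` to
every element of the right ideal `p𝕀 + n𝕀`, hence `csl p` depends only on `n` and that ideal.

All right ideals of `𝕀` are principal, so that the greatest left common divisors of `p` and `n` are
the generators of `p𝕀 + n𝕀`. This holds because `𝕀` is norm-Euclidean: in half-integral coordinates
that make the trace form Euclidean, `𝕀` is the lattice of integer points that satisfy the parity
checks of the extended Hamming code. Since this code has covering radius `2`, rounding all eight
coordinates of a point and moving at most two of them to the second nearest integer gives an icosian
close enough to it. -/

section RightIdeals

open MulOpposite Submodule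

variable {S : Type*} [Ring S]

theorem rightIdeal_isPrincipal_of_right_division (ν : S → ℕ)
    (hν : ∀ g y : S, g ≠ 0 → ∃ i, ν (y - g * i) < ν g) (J : Submodule Sᵐᵒᵖ S) :
    J.IsPrincipal := by
  by_cases hJ : J = ⊥
  · exact hJ ▸ bot_isPrincipal
  obtain ⟨g, ⟨hgJ, hg0⟩, hmin⟩ :=
    (measure ν).wf.has_min {x | x ∈ J ∧ x ≠ 0} (J.exists_mem_ne_zero_of_ne_bot hJ)
  refine ⟨g, le_antisymm (fun y hy => ?_) ((span_singleton_le_iff_mem g J).2 hgJ)⟩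
  obtain ⟨i, hi⟩ := hν g y hg0
  have hrem : y - g * i ∈ J := sub_mem hy (J.smul_mem (op i) hgJ)
  have hzero : y - g * i = 0 := by
    by_contra hne
    exact hmin _ ⟨hrem, hne⟩ hi
  exact mem_span_singleton.2 ⟨op i, (sub_eq_zero.1 hzero).symm⟩

theorem span_op_singleton_le_iff_dvd {c d : S} : span Sᵐᵒᵖ {d} ≤ span Sᵐᵒᵖ {c} ↔ c ∣ d := by
  rw [span_singleton_le_iff_mem, mem_span_singleton]
  exact ⟨fun ⟨x, hx⟩ => ⟨unop x, hx.symm⟩, fun ⟨x, hx⟩ => ⟨op x, hx.symm⟩⟩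

theorem span_op_pair_le_iff_dvd {a b c : S} :
    span Sᵐᵒᵖ {a, b} ≤ span Sᵐᵒᵖ {c} ↔ c ∣ a ∧ c ∣ b := by
  rw [span_insert, sup_le_iff, span_op_singleton_le_iff_dvd, span_op_singleton_le_iff_dvd]

theorem span_op_singleton_eq_span_op_pair_iff {a b d : S} (hab : (span Sᵐᵒᵖ {a, b}).IsPrincipal) :
    span Sᵐᵒᵖ {d} = span Sᵐᵒᵖ {a, b} ↔ d ∣ a ∧ d ∣ b ∧ ∀ c, c ∣ a → c ∣ b → c ∣ d := by
  rw [← and_assoc, ← span_op_pair_le_iff_dvd]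
  simp only [← span_op_singleton_le_iff_dvd (c := _) (d := d), ← and_imp,
    ← span_op_pair_le_iff_dvd]
  refine ⟨fun h => ⟨h.ge, fun c => h.trans_le⟩, fun ⟨hle, hgreatest⟩ => ?_⟩
  obtain ⟨g, hg⟩ := hab.principal
  exact le_antisymm (hg ▸ hgreatest g hg.le) hle

theorem natCast_dvd_mul_of_dvd_right {n : ℕ} {x : S} (h : (n : S) ∣ x) (y : S) :
    (n : S) ∣ y * x := by
  obtain ⟨w, rfl⟩ := h
  exact ⟨y * w, (n.cast_commute y).symm.left_comm w⟩

theorem natCast_dvd_star_mul_mul_of_mem_span [StarRing S] (σ : S →+* S) {n : ℕ} {p q z : S}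
    (hq : q ∈ span Sᵐᵒᵖ {p, (n : S)}) (hp : (n : S) ∣ star p * z * σ p) :
    (n : S) ∣ star q * z * σ q := by
  obtain ⟨⟨u⟩, ⟨v⟩, rfl⟩ := mem_span_pair.1 hq
  change (n : S) ∣ star (p * u + n * v) * z * σ (p * u + n * v)
  have star_q : star (p * u + n * v) = star u * star p + n * star v := by
    rw [star_add, star_mul, star_mul, star_natCast, n.cast_comm]
  have dvd_pp : (n : S) ∣ star u * (star p * z * σ p) * σ u :=
    (natCast_dvd_mul_of_dvd_right hp _).mul_right _
  have dvd_pn : (n : S) ∣ star u * star p * z * (n * σ v) :=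
    natCast_dvd_mul_of_dvd_right (dvd_mul_right _ _) _
  have dvd_nq : (n : S) ∣ n * (star v * z * σ (p * u + n * v)) := dvd_mul_right _ _
  convert dvd_add (dvd_add dvd_pp dvd_pn) dvd_nq using 1
  simp only [star_q, map_add, map_mul, map_natCast, add_mul, mul_add, mul_assoc]
  abel

end RightIdeals

section Rounding

theorem exists_intCast_eq_sq_sub_le {𝕜 : Type*} [Field 𝕜] [LinearOrder 𝕜] [IsStrictOrderedRing 𝕜]
    [FloorRing 𝕜] (x : 𝕜) (e : ZMod 2) :
    ∃ z : ℤ, (z : ZMod 2) = round x + e ∧ (x - z) ^ 2 ≤ 1 / 4 + if e = 0 then 0 else 3 / 4 := by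
  obtain ⟨hlo, hhi⟩ := abs_le.1 (abs_sub_round x)
  obtain rfl | rfl : e = 0 ∨ e = 1 := by revert e; decide
  · exact ⟨round x, by simp, by rw [if_pos rfl]; nlinarith⟩
  rw [if_neg one_ne_zero]
  obtain h | h := le_total 0 (x - round x)
  · refine ⟨round x + 1, by push_cast; rfl, ?_⟩
    push_cast
    nlinarith
  · refine ⟨round x - 1, by rw [Int.cast_sub, Int.cast_one, CharTwo.sub_eq_add], ?_⟩
    push_cast
    nlinarith

theorem exists_int_mulVec_eq_zero_sum_sq_sub_le {𝕜 ι m : Type*} [Field 𝕜] [LinearOrder 𝕜]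
    [IsStrictOrderedRing 𝕜] [FloorRing 𝕜] [Fintype ι] (H : Matrix m ι (ZMod 2)) {r : ℕ}
    (hH : ∀ s, ∃ e, hammingNorm e ≤ r ∧ H.mulVec e = s) (x : ι → 𝕜) :
    ∃ z : ι → ℤ, H.mulVec (fun i => (z i : ZMod 2)) = 0 ∧
      ∑ i, (x i - z i) ^ 2 ≤ Fintype.card ι / 4 + 3 / 4 * r := by
  obtain ⟨e, he, hsyndrome⟩ := hH (-H.mulVec fun i => (round (x i) : ZMod 2))
  choose z hz hdist using fun i => exists_intCast_eq_sq_sub_le (x i) (e i)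
  refine ⟨z, ?_, (Finset.sum_le_sum fun i _ => hdist i).trans ?_⟩
  · have hz' : (fun i => (z i : ZMod 2)) = (fun i => (round (x i) : ZMod 2)) + e := funext hz
    rw [hz', Matrix.mulVec_add, hsyndrome, add_neg_cancel]
  · have hcard : ((Finset.univ.filter fun i => e i ≠ 0).card : 𝕜) ≤ r := by exact_mod_cast he
    simp only [Finset.sum_add_distrib, Finset.sum_const, Finset.card_univ, nsmul_eq_mul,
      ← ite_not (e _ = 0), ← Finset.sum_filter]
    linarith

/-- A parity check matrix of the extended Hamming code of length `8`. Its columns are the vectors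
of odd weight, in the order in which the corresponding coordinates occur in `halfCoords`. -/
def extendedHammingParityCheck : Matrix (Fin 4) (Fin 8) (ZMod 2) :=
  !![0, 0, 1, 0, 0, 1, 1, 1;
     0, 0, 0, 1, 1, 1, 1, 0;
     1, 0, 0, 0, 1, 1, 0, 1;
     0, 1, 0, 0, 1, 0, 1, 1]

set_option maxRecDepth 10000 in
theorem exists_hammingNorm_le_two_mulVec_eq (s : Fin 4 → ZMod 2) :
    ∃ e, hammingNorm e ≤ 2 ∧ extendedHammingParityCheck.mulVec e = s := by
  revert s
  decide

end Rounding

section Quaternion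

open Quaternion

theorem star_mul_mul_mul_mul_star {A : Type*} [CommRing A] (a x b : ℍ[A]) :
    star a * (a * x * b) * star b = (normSq a * normSq b) • x := by
  calc star a * (a * x * b) * star b = star a * a * x * (b * star b) := by simp only [mul_assoc]
    _ = (normSq a * normSq b) • x := by
      rw [star_mul_self, self_mul_star, coe_mul_eq_smul, mul_coe_eq_smul, smul_smul, mul_comm]

end Quaternion

noncomputable section

namespace Icosian

open Quaternion QuadraticAlgebra

section Field

attribute [simps] conj twist τ

/-- The golden ratio as an element of `ℤ[τ]`. -/
def τₒ : 𝔬 := ⟨τ, 0, 1, by simp⟩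

@[simp]
theorem coe_τₒ : (τₒ : K) = τ := rfl

@[simp]
theorem coe_ofNat (n : ℕ) [n.AtLeastTwo] : ((ofNat(n) : 𝔬) : K) = ofNat(n) := rfl

theorem conj_eq_star (α : K) : conj α = star α := by
  ext <;> simp

/-- Algebraic conjugation as an automorphism of `ℤ[τ]`. -/
def conjₒ (α : 𝔬) : 𝔬 :=
  ⟨conj α, by
    obtain ⟨_, m, n, rfl⟩ := α
    refine ⟨m + n, -n, ?_⟩
    ext <;> simp
    ring⟩

@[simp]
theorem coe_conjₒ (α : 𝔬) : (conjₒ α : K) = conj α := rfl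

theorem toReal_apply (α : K) : toReal α = α.re + α.im * √5 := by
  simp [toReal, QuadraticAlgebra.lift, Algebra.smul_def]

theorem toReal_injective : Function.Injective toReal := by
  have : Fact (∀ r : ℚ, r ^ 2 ≠ 5 + 0 * r) := ⟨fun r hr => by
    have irrational_sqrt_five : Irrational √5 := by
      exact_mod_cast Nat.Prime.irrational_sqrt (p := 5) (by norm_num)
    refine irrational_sqrt_five ⟨|r|, ?_⟩
    rw [Rat.cast_abs, ← Real.sqrt_sq_eq_abs]
    congr 1
    exact_mod_cast hr.trans (by ring)⟩
  exact toReal.toRingHom.injective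

theorem toReal_τ : toReal τ = Real.goldenRatio := by
  rw [toReal_apply, Real.goldenRatio, re_τ, im_τ]
  push_cast
  ring

theorem toReal_mul_toReal_conj (α : K) :
    toReal α * toReal (conj α) = (QuadraticAlgebra.norm α : ℚ) := by
  rw [conj_eq_star, ← map_mul, ← algebraMap_norm_eq_mul_star, AlgHom.commutes]
  rfl

theorem norm_le_sq_re_add_im (α : K) : QuadraticAlgebra.norm α ≤ 5 / 4 * (α.re + α.im) ^ 2 := by
  rw [QuadraticAlgebra.norm_def]
  nlinarith [sq_nonneg (α.re + 5 * α.im)]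

end Field

section Quaternions

theorem twist_add (x y : ℍ[K]) : twist (x + y) = twist x + twist y := by
  ext <;> simp [add_comm]

theorem twist_mul (x y : ℍ[K]) : twist (x * y) = twist y * twist x := by
  ext <;> simp <;> ring

theorem twist_twist (x : ℍ[K]) : twist (twist x) = x := by
  ext <;> simp

theorem twist_star (x : ℍ[K]) : twist (star x) = star (twist x) := by
  ext <;> simp

theorem twist_natCast (n : ℕ) : twist (n : ℍ[K]) = n := by
  ext <;> simp

/-- The ring automorphism `x ↦ twist (star x)` of `ℍ(K)`: the twist map and the quaternion
conjugation both reverse products. -/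
def twistStar : ℍ[K] →+* ℍ[K] where
  toFun x := twist (star x)
  map_zero' := by ext <;> simp
  map_one' := by ext <;> simp
  map_add' x y := (congrArg twist (star_add x y)).trans (twist_add _ _)
  map_mul' x y := by rw [star_mul, twist_mul]

theorem conj_normSq (x : ℍ[K]) : conj (normSq x) = normSq (twist x) := by
  ext <;> simp [normSq_def', pow_two] <;> ring

attribute [simps] toRealQuat

/-- `toRealQuat` as a ring homomorphism. -/
def toRealQuatHom : ℍ[K] →+* ℍ[ℝ] where
  toFun := toRealQuat
  map_zero' := by ext <;> exact map_zero toReal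
  map_one' := by ext <;> first | exact map_one toReal | exact map_zero toReal
  map_add' x y := by ext <;> exact map_add toReal _ _
  map_mul' x y := by ext <;> simp

theorem toRealQuatHom_apply (x : ℍ[K]) : toRealQuatHom x = toRealQuat x := rfl

theorem toRealQuatHom_injective : Function.Injective toRealQuatHom := fun _ _ h =>
  QuaternionAlgebra.ext (toReal_injective congr(($h).re)) (toReal_injective congr(($h).imI))
    (toReal_injective congr(($h).imJ)) (toReal_injective congr(($h).imK))

theorem toRealQuatHom_star (x : ℍ[K]) : toRealQuatHom (star x) = star (toRealQuatHom x) := by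
  ext <;> simp [toRealQuatHom_apply]

theorem len_mul (x y : ℍ[K]) : len (x * y) = len x * len y := by
  rw [len, ← toRealQuatHom_apply, map_mul, norm_mul]
  rfl

theorem len_star (x : ℍ[K]) : len (star x) = len x := by
  rw [len, ← toRealQuatHom_apply, toRealQuatHom_star, norm_star]
  rfl

theorem len_eq_zero {x : ℍ[K]} : len x = 0 ↔ x = 0 := by
  rw [len, norm_eq_zero, ← toRealQuatHom_apply, map_eq_zero_iff _ toRealQuatHom_injective]

theorem len_sq (x : ℍ[K]) : len x ^ 2 = toReal (normSq x) := by
  rw [len, pow_two, ← normSq_eq_norm_mul_self, normSq_def', normSq_def']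
  simp only [map_add, map_pow]
  rfl

theorem len_mul_twist_ne_zero {p : ℍ[K]} (hp : p ≠ 0) : len (p * twist p) ≠ 0 := by
  rw [len_mul, mul_ne_zero_iff, Ne, Ne, len_eq_zero, len_eq_zero]
  refine ⟨hp, fun h => hp ?_⟩
  rw [← twist_twist p, h]
  ext <;> simp

/-- The absolute norm of a quaternion over `ℚ(√5)`: the field norm of the reduced norm. -/
def absNorm (x : ℍ[K]) : ℚ := QuadraticAlgebra.norm (normSq x)

theorem absNorm_mul (x y : ℍ[K]) : absNorm (x * y) = absNorm x * absNorm y := by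
  rw [absNorm, map_mul, map_mul, absNorm, absNorm]

theorem absNorm_eq_sq_len_mul_twist (x : ℍ[K]) : (absNorm x : ℝ) = len (x * twist x) ^ 2 := by
  rw [absNorm, ← toReal_mul_toReal_conj, conj_normSq, len_mul, mul_pow, len_sq, len_sq]

theorem absNorm_nonneg (x : ℍ[K]) : 0 ≤ absNorm x := by
  have := sq_nonneg (len (x * twist x))
  rw [← absNorm_eq_sq_len_mul_twist] at this
  exact_mod_cast this

theorem absNorm_pos {x : ℍ[K]} (hx : x ≠ 0) : 0 < absNorm x := by
  have := sq_pos_of_ne_zero (len_mul_twist_ne_zero hx)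
  rw [← absNorm_eq_sq_len_mul_twist] at this
  exact_mod_cast this

theorem natCast_eq_of_len_eq {p₁ p₂ : ℍ[K]} {n₁ n₂ : ℕ} (hn₁ : (n₁ : ℝ) = len (p₁ * twist p₁))
    (hn₂ : (n₂ : ℝ) = len (p₂ * twist p₂)) (hnorm : len p₁ ^ 2 = len p₂ ^ 2) : n₁ = n₂ := by
  have normSq_eq : normSq p₁ = normSq p₂ :=
    toReal_injective <| (len_sq p₁).symm.trans (hnorm.trans (len_sq p₂))
  have sq_eq : (n₁ : ℝ) ^ 2 = (n₂ : ℝ) ^ 2 := by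
    rw [hn₁, hn₂, ← absNorm_eq_sq_len_mul_twist, ← absNorm_eq_sq_len_mul_twist, absNorm, absNorm,
      normSq_eq]
  exact Nat.pow_left_injective two_ne_zero (by exact_mod_cast sq_eq)

end Quaternions

section IcosianRing

/-- The icosian with coordinates `a, b, c, d` in the basis that defines `𝕀`. -/
@[simps]
def ofCoords (a b c d : 𝔬) : ℍ[K] where
  re := a + (1 / 2 : ℚ) • (c + (1 - τ) * d)
  imI := b + (1 / 2 : ℚ) • (c + τ * d)
  imJ := (1 / 2 : ℚ) • c
  imK := (1 / 2 : ℚ) • (c + d)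

theorem icosian_eq_span : 𝕀 = Submodule.span 𝔬
    {ofCoords 1 0 0 0, ofCoords 0 1 0 0, ofCoords 0 0 1 0, ofCoords 0 0 0 1} := by
  rw [𝕀]
  congr <;> ext <;> simp

theorem ofCoords_eq_smul_add (a b c d : 𝔬) : ofCoords a b c d =
    a • ofCoords 1 0 0 0 + (b • ofCoords 0 1 0 0 +
      (c • ofCoords 0 0 1 0 + d • ofCoords 0 0 0 1)) := by
  ext <;> simp [Subring.smul_def] <;> ring

theorem mem_icosian_iff {x : ℍ[K]} : x ∈ 𝕀 ↔ ∃ a b c d, ofCoords a b c d = x := by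
  simp only [icosian_eq_span, Submodule.mem_span_insert, Submodule.mem_span_singleton]
  constructor
  · rintro ⟨a, _, ⟨b, _, ⟨c, _, ⟨d, rfl⟩, rfl⟩, rfl⟩, rfl⟩
    exact ⟨a, b, c, d, ofCoords_eq_smul_add a b c d⟩
  · rintro ⟨a, b, c, d, rfl⟩
    exact ⟨a, _, ⟨b, _, ⟨c, _, ⟨d, rfl⟩, rfl⟩, rfl⟩, ofCoords_eq_smul_add a b c d⟩

theorem ofCoords_mem_icosian (a b c d : 𝔬) : ofCoords a b c d ∈ 𝕀 :=
  mem_icosian_iff.2 ⟨a, b, c, d, rfl⟩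

theorem ofCoords_mul_ofCoords (a b c d a' b' c' d' : 𝔬) :
    ofCoords a b c d * ofCoords a' b' c' d' = ofCoords
      (a * a' - b * b' + (τₒ - 1) * b * c' - τₒ * c * b' - c * c' - c * d' - τₒ * d * b' - d * d')
      (a * b' + b * a' + (1 - τₒ) * b * c' + (1 - τₒ) * b * d' + τₒ * c * b' + c * d' - d * c')
      (a * c' + c * a' - b * c' - b * d' + c * b' + c * c' + d * b' + (1 - τₒ) * d * c')
      (a * d' + d * a' + 2 * b * c' + b * d' - 2 * c * b' + (1 - τₒ) * c * d' - d * b'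
        + τₒ * d * c' + (1 - τₒ) * d * d') := by
  have hτ := τ_mul_τ
  obtain ⟨η, hη⟩ : ∃ η : K, η = algebraMap ℚ K (1 / 2) := ⟨_, rfl⟩
  have two_mul_η : 2 * η = 1 := by rw [hη]; ext <;> simp
  have half_smul (x : K) : (1 / 2 : ℚ) • x = η * x := by rw [hη, Algebra.smul_def]
  ext1 <;> simp only [Quaternion.re_mul, Quaternion.imI_mul, Quaternion.imJ_mul,
    Quaternion.imK_mul, re_ofCoords, imI_ofCoords, imJ_ofCoords, imK_ofCoords, half_smul,
    Subring.coe_add, AddSubgroupClass.coe_sub, Subring.coe_mul, Subring.coe_one, coe_ofNat, coe_τₒ]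
  all_goals
    clear hη half_smul
    generalize τ = t at *
    grind

theorem star_ofCoords (a b c d : 𝔬) :
    star (ofCoords a b c d) = ofCoords (a + c + (1 - τₒ) * d) (-b) (-c) (-d) := by
  ext <;> simp <;> ring

theorem twist_ofCoords (a b c d : 𝔬) :
    twist (ofCoords a b c d) =
      ofCoords (conjₒ a) (conjₒ b) (conjₒ c + conjₒ d) (-conjₒ d) := by
  ext <;> simp <;> ring

/-- The icosian ring `𝕀` as a ring with the quaternion conjugation as its involution. -/
def icosianRing : StarSubalgebra ℤ ℍ[K] where
  carrier := 𝕀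
  add_mem' := add_mem
  mul_mem' := by
    intro x y hx hy
    obtain ⟨a, b, c, d, rfl⟩ := mem_icosian_iff.1 hx
    obtain ⟨a', b', c', d', rfl⟩ := mem_icosian_iff.1 hy
    rw [ofCoords_mul_ofCoords]
    exact ofCoords_mem_icosian _ _ _ _
  algebraMap_mem' n := mem_icosian_iff.2 ⟨n, 0, 0, 0, by ext <;> simp⟩
  star_mem' := by
    intro x hx
    obtain ⟨a, b, c, d, rfl⟩ := mem_icosian_iff.1 hx
    rw [star_ofCoords]
    exact ofCoords_mem_icosian _ _ _ _

theorem twist_mem_icosian {x : ℍ[K]} (hx : x ∈ 𝕀) : twist x ∈ 𝕀 := by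
  obtain ⟨a, b, c, d, rfl⟩ := mem_icosian_iff.1 hx
  rw [twist_ofCoords]
  exact ofCoords_mem_icosian _ _ _ _

/-- The restriction of `twistStar` to the icosian ring. -/
def icosianTwistStar : icosianRing →+* icosianRing :=
  twistStar.restrict icosianRing icosianRing fun _ hx =>
    twist_mem_icosian (icosianRing.star_mem' hx)

theorem leftDvd_coe_iff {c a : icosianRing} : LeftDvd (c : ℍ[K]) a ↔ c ∣ a :=
  ⟨fun ⟨x, hx, h⟩ => ⟨⟨x, hx⟩, Subtype.ext h⟩, fun ⟨x, h⟩ => ⟨x, x.2, congrArg Subtype.val h⟩⟩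

theorem coe_mem_glcd_iff {a b d : icosianRing} :
    (d : ℍ[K]) ∈ glcd (a : ℍ[K]) b ↔ d ∣ a ∧ d ∣ b ∧ ∀ c, c ∣ a → c ∣ b → c ∣ d := by
  simp only [← leftDvd_coe_iff]
  exact ⟨fun ⟨_, ha, hb, h⟩ => ⟨ha, hb, fun c => h c c.2⟩,
    fun ⟨ha, hb, h⟩ => ⟨d.2, ha, hb, fun c hc => h ⟨c, hc⟩⟩⟩

theorem normSq_mem_of_mem_icosian {x : ℍ[K]} (hx : x ∈ 𝕀) : normSq x ∈ 𝔬 := by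
  have mul_star_mem : x * star x ∈ 𝕀 := icosianRing.mul_mem hx (icosianRing.star_mem' hx)
  rw [self_mul_star] at mul_star_mem
  obtain ⟨a, b, c, d, h⟩ := mem_icosian_iff.1 mul_star_mem
  have hc : (c : K) = 0 := by simpa using congr(($h).imJ)
  have hd : (d : K) = 0 := by simpa [hc] using congr(($h).imK)
  have ha : (a : K) = normSq x := by simpa [hc, hd] using congr(($h).re)
  exact ha ▸ a.2

theorem exists_natCast_eq_absNorm {x : ℍ[K]} (hx : x ∈ 𝕀) : ∃ k : ℕ, (k : ℚ) = absNorm x := by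
  obtain ⟨m, n, h⟩ := normSq_mem_of_mem_icosian hx
  have absNorm_eq : ((m ^ 2 + m * n - n ^ 2 : ℤ) : ℚ) = absNorm x := by
    rw [absNorm, h, QuadraticAlgebra.norm_def]
    simp
    ring
  have form_nonneg : 0 ≤ m ^ 2 + m * n - n ^ 2 := by
    exact_mod_cast absNorm_eq ▸ absNorm_nonneg x
  lift m ^ 2 + m * n - n ^ 2 to ℕ using form_nonneg with k
  exact ⟨k, by exact_mod_cast absNorm_eq⟩

theorem IsPrimitive.ne_zero {p : ℍ[K]} (hp : IsPrimitive p) : p ≠ 0 := by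
  rintro rfl
  obtain ⟨m, n, h⟩ := hp.2 ⟨1 / 2, 0⟩ (by rw [smul_zero]; exact zero_mem 𝕀)
  have hn : (n : ℚ) = 0 := by simpa using congr(($h).im).symm
  have hm : 2 * (m : ℚ) = 1 := by
    linear_combination (norm := simp [hn]) -2 * congr(($h).re)
  have hm' : 2 * m = 1 := by exact_mod_cast hm
  lia

end IcosianRing

section Euclidean

/-- The coordinates of `2 * x` in the `ℚ`-basis of `ℍ(K)` given by the multiples of the quaternion
units by `1` and `τ - 1`. This basis is orthonormal for the quadratic form that sends `x` to
`r + s`, where `r + s √5` is the reduced norm of `x`. -/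
def halfCoords (x : ℍ[K]) : Fin 8 → ℚ :=
  ![2 * (x.re.re + x.re.im), 4 * x.re.im, 2 * (x.imI.re + x.imI.im), 4 * x.imI.im,
    2 * (x.imJ.re + x.imJ.im), 4 * x.imJ.im, 2 * (x.imK.re + x.imK.im), 4 * x.imK.im]

theorem halfCoords_sub (x y : ℍ[K]) : halfCoords (x - y) = halfCoords x - halfCoords y := by
  ext i
  fin_cases i <;> simp [halfCoords] <;> ring

theorem re_add_im_normSq (x : ℍ[K]) :
    (normSq x).re + (normSq x).im = (∑ i, halfCoords x i ^ 2) / 4 := by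
  simp [Fin.sum_univ_eight, halfCoords, normSq_def', pow_two]
  ring

theorem exists_mem_icosian_halfCoords_eq (z : Fin 8 → ℤ)
    (hz : extendedHammingParityCheck.mulVec (fun i => (z i : ZMod 2)) = 0) :
    ∃ q ∈ 𝕀, halfCoords q = fun i => (z i : ℚ) := by
  have even (i : Fin 4) : ((2 : ℕ) : ℤ) ∣ ∑ j, (extendedHammingParityCheck i j).val * z j := by
    rw [← ZMod.intCast_zmod_eq_zero_iff_dvd]
    simpa [Matrix.mulVec, dotProduct] using congrFun hz i
  choose k hk using even
  obtain ⟨h₁, h₂, h₃, h₄⟩ : z 2 + z 5 + z 6 + z 7 = 2 * k 0 ∧ z 3 + z 4 + z 5 + z 6 = 2 * k 1 ∧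
      z 0 + z 4 + z 5 + z 7 = 2 * k 2 ∧ z 1 + z 4 + z 6 + z 7 = 2 * k 3 := by
    simpa [Fin.forall_fin_succ, extendedHammingParityCheck, Fin.sum_univ_eight, ZMod.val_one,
      -ZMod.natCast_val] using hk
  refine ⟨ofCoords ((k 2 - z 4 - z 5 : ℤ) + (k 3 - z 4 - z 7 : ℤ) * (τₒ - 1))
    ((k 0 - z 6 - z 7 : ℤ) + (k 1 - z 5 - z 6 : ℤ) * (τₒ - 1)) (z 4 + z 5 * (τₒ - 1))
    ((z 6 - z 4 : ℤ) + (z 7 - z 5 : ℤ) * (τₒ - 1)), ofCoords_mem_icosian _ _ _ _, ?_⟩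
  qify at h₁ h₂ h₃ h₄
  ext i
  fin_cases i <;> simp [halfCoords] <;> linarith

theorem exists_icosian_absNorm_sub_lt_one (x : ℍ[K]) : ∃ q ∈ 𝕀, absNorm (x - q) < 1 := by
  obtain ⟨z, hz, hdist⟩ := exists_int_mulVec_eq_zero_sum_sq_sub_le extendedHammingParityCheck
    exists_hammingNorm_le_two_mulVec_eq (halfCoords x)
  obtain ⟨q, hq, hqz⟩ := exists_mem_icosian_halfCoords_eq z hz
  refine ⟨q, hq, (norm_le_sq_re_add_im _).trans_lt ?_⟩
  have form_le : (normSq (x - q)).re + (normSq (x - q)).im ≤ 7 / 8 := by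
    rw [re_add_im_normSq, halfCoords_sub, hqz, div_le_iff₀ four_pos]
    exact hdist.trans (by norm_num)
  have form_nonneg : 0 ≤ (normSq (x - q)).re + (normSq (x - q)).im := by
    rw [re_add_im_normSq]
    positivity
  nlinarith

theorem isUnit_of_ne_zero {g : ℍ[K]} (hg : g ≠ 0) : IsUnit g := by
  have isUnit_normSq : IsUnit (normSq g) :=
    isUnit_iff_norm_isUnit.2 (absNorm_pos hg).ne'.isUnit
  have isUnit_mul_star : IsUnit (g * star g) :=
    self_mul_star g ▸ isUnit_normSq.map (algebraMap K ℍ[K])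
  have commute_star : Commute g (star g) := (self_mul_star g).trans (star_mul_self g).symm
  exact (commute_star.isUnit_mul_iff.1 isUnit_mul_star).1

theorem exists_absNorm_sub_mul_lt {g : ℍ[K]} (hg : g ≠ 0) (y : ℍ[K]) :
    ∃ q ∈ 𝕀, absNorm (y - g * q) < absNorm g := by
  obtain ⟨x, rfl⟩ := (isUnit_of_ne_zero hg).dvd (a := y)
  obtain ⟨q, hq, hlt⟩ := exists_icosian_absNorm_sub_lt_one x
  refine ⟨q, hq, ?_⟩
  rw [← mul_sub, absNorm_mul]
  exact mul_lt_of_lt_one_right (absNorm_pos hg) hlt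

theorem icosianRing_isPrincipal (J : Submodule icosianRingᵐᵒᵖ icosianRing) : J.IsPrincipal := by
  choose ν hν using fun x : icosianRing => exists_natCast_eq_absNorm x.2
  refine rightIdeal_isPrincipal_of_right_division ν (fun g y hg => ?_) J
  obtain ⟨q, hq, hlt⟩ := exists_absNorm_sub_mul_lt (Subtype.coe_ne_coe.2 hg) y
  refine ⟨⟨q, hq⟩, ?_⟩
  rw [← Nat.cast_lt (α := ℚ), hν, hν]
  exact hlt

theorem span_op_pair_eq_of_glcd_eq {a b c d : icosianRing}
    (h : glcd (a : ℍ[K]) b = glcd (c : ℍ[K]) d) :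
    Submodule.span icosianRingᵐᵒᵖ {a, b} = Submodule.span icosianRingᵐᵒᵖ {c, d} := by
  obtain ⟨g, hg⟩ := (icosianRing_isPrincipal (Submodule.span icosianRingᵐᵒᵖ {a, b})).principal
  have mem_left : (g : ℍ[K]) ∈ glcd (a : ℍ[K]) b :=
    coe_mem_glcd_iff.2
      ((span_op_singleton_eq_span_op_pair_iff (icosianRing_isPrincipal _)).1 hg.symm)
  have mem_right : (g : ℍ[K]) ∈ glcd (c : ℍ[K]) d := h ▸ mem_left
  exact hg.trans ((span_op_singleton_eq_span_op_pair_iff (icosianRing_isPrincipal _)).2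
    (coe_mem_glcd_iff.1 mem_right))

end Euclidean

section Lattice

/-- The additive group of the icosians that are fixed by the twist map. -/
def fixedIcosians : AddSubgroup ℍ[K] where
  carrier := {x | x ∈ 𝕀 ∧ twist x = x}
  zero_mem' := ⟨zero_mem 𝕀, by ext <;> simp⟩
  add_mem' := fun ⟨hx, tx⟩ ⟨hy, ty⟩ => ⟨add_mem hx hy, by rw [twist_add, tx, ty]⟩
  neg_mem' {x} := fun ⟨hx, tx⟩ => by
    refine ⟨neg_mem hx, ?_⟩
    nth_rw 2 [← tx]
    ext <;> simp

theorem exists_zsmul_add_eq_of_mem_fixedIcosians {x : ℍ[K]} (hx : x ∈ fixedIcosians) :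
    ∃ k₁ k₂ k₃ k₄ : ℤ, x = k₁ • ofCoords 1 0 0 0 + k₂ • ofCoords (-1) 0 1 0
      + k₃ • ofCoords 0 (-1) 0 0 + k₄ • ofCoords (-1) 2 (τₒ - 1) (1 - 2 * τₒ) := by
  obtain ⟨hx, tx⟩ := hx
  obtain ⟨⟨_, a, a', rfl⟩, ⟨_, b, b', rfl⟩, ⟨_, c, c', rfl⟩, ⟨_, d, d', rfl⟩, rfl⟩ :=
    mem_icosian_iff.1 hx
  have hd' : (d' : ℚ) = -2 * c' := by
    linear_combination (norm := (simp; ring)) -4 * congr(($tx).imJ.im)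
  have hd : (d : ℚ) = c' := by
    linear_combination (norm := (simp; ring)) 2 * congr(($tx).imJ.re) - hd' / 2
  have ha' : (a' : ℚ) = 0 := by
    linear_combination (norm := (simp; ring)) -congr(($tx).re.im) + hd / 2
  have hb' : (b' : ℚ) = 0 := by
    linear_combination (norm := (simp; ring)) -congr(($tx).imI.im) - hd' / 2 - hd / 2
  refine ⟨a + c + c' + c', c + c', c' + c' - b, c', ?_⟩
  ext <;> simp [ha', hb', hd, hd'] <;> ring

theorem fixedIcosians_eq_closure : fixedIcosians = AddSubgroup.closure
    {ofCoords 1 0 0 0, ofCoords (-1) 0 1 0, ofCoords 0 (-1) 0 0,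
      ofCoords (-1) 2 (τₒ - 1) (1 - 2 * τₒ)} := by
  refine le_antisymm (fun x hx => ?_) ((AddSubgroup.closure_le _).2 ?_)
  · obtain ⟨k₁, k₂, k₃, k₄, rfl⟩ := exists_zsmul_add_eq_of_mem_fixedIcosians hx
    refine add_mem (add_mem (add_mem ?_ ?_) ?_) ?_ <;>
      exact zsmul_mem (AddSubgroup.subset_closure (by simp)) _
  · rintro _ (rfl | rfl | rfl | rfl) <;> refine ⟨ofCoords_mem_icosian _ _ _ _, ?_⟩
    all_goals ext <;> simp <;> norm_num

theorem map_fixedIcosians : fixedIcosians.map toRealQuatHom.toAddMonoidHom = L := by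
  rw [fixedIcosians_eq_closure, AddMonoidHom.map_closure, L, ← toReal_τ]
  simp only [Set.image_insert_eq, Set.image_singleton]
  congr <;> ext <;> simp [toRealQuatHom_apply, toReal_apply, Rat.smul_def]
  all_goals ring

theorem inv_smul_toRealQuat_mem_L_iff {n : ℕ} (hn : n ≠ 0) {x : ℍ[K]} (hx : twist x = x) :
    (n : ℝ)⁻¹ • toRealQuat x ∈ L ↔ LeftDvd (n : ℍ[K]) x := by
  have hn_real : (n : ℝ) ≠ 0 := Nat.cast_ne_zero.2 hn
  have natCast_smul (w : ℍ[K]) : (n : ℝ) • toRealQuatHom w = toRealQuatHom (n * w) := by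
    rw [map_mul, map_natCast, Nat.cast_smul_eq_nsmul, nsmul_eq_mul]
  have inv_smul_eq_iff (w : ℍ[K]) : toRealQuatHom w = (n : ℝ)⁻¹ • toRealQuatHom x ↔ n * w = x := by
    rw [eq_inv_smul_iff₀ hn_real, natCast_smul, toRealQuatHom_injective.eq_iff]
  rw [← map_fixedIcosians, AddSubgroup.mem_map]
  constructor
  · rintro ⟨w, ⟨hw, -⟩, h⟩
    exact ⟨w, hw, ((inv_smul_eq_iff w).1 h).symm⟩
  · rintro ⟨w, hw, h⟩
    have w_eq := (inv_smul_eq_iff w).2 h.symm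
    refine ⟨w, ⟨hw, toRealQuatHom_injective ?_⟩, w_eq⟩
    refine ((inv_smul_eq_iff _).2 ?_).trans w_eq.symm
    rw [n.cast_comm, ← twist_natCast, ← twist_mul, ← h, hx]

theorem R_apply_toRealQuat (q x : ℍ[K]) :
    R q (toRealQuat x) = (len (q * twist q))⁻¹ • toRealQuat (q * x * twist q) := by
  rw [← toRealQuatHom_apply (_ * _), map_mul, map_mul, mul_assoc]
  rfl

theorem len_star_mul_twist_star (p : ℍ[K]) :
    len (star p * twist (star p)) = len (p * twist p) := by
  rw [twist_star, len_mul, len_star, len_star, len_mul]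

theorem R_star_R {p : ℍ[K]} (hp : p ≠ 0) (x : ℍ[ℝ]) : R (star p) (R p x) = x := by
  set P := toRealQuat p
  set Q := toRealQuat (twist p)
  set ℓ := len (p * twist p)
  have sq_ℓ : ℓ ^ 2 = normSq P * normSq Q := by
    rw [normSq_eq_norm_mul_self, normSq_eq_norm_mul_self, ← pow_two, ← pow_two, ← mul_pow]
    exact congr($(len_mul p (twist p)) ^ 2)
  calc R (star p) (R p x) = ℓ⁻¹ • (star P * ((ℓ⁻¹ • (P * (x * Q))) * star Q)) := by
        rw [R, len_star_mul_twist_star, twist_star, ← toRealQuatHom_apply, ← toRealQuatHom_apply,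
          toRealQuatHom_star, toRealQuatHom_star]
        rfl
    _ = (ℓ ^ 2)⁻¹ • (star P * (P * x * Q) * star Q) := by
        rw [smul_mul_assoc, mul_smul_comm, smul_smul, ← mul_inv, ← pow_two]
        simp only [mul_assoc]
    _ = x := by
        rw [star_mul_mul_mul_mul_star, ← sq_ℓ,
          inv_smul_smul₀ (pow_ne_zero 2 (len_mul_twist_ne_zero hp))]

theorem mem_map_R_iff {p : ℍ[K]} (hp : p ≠ 0) {y : ℍ[ℝ]} :
    y ∈ L.map (R p).toAddMonoidHom ↔ R (star p) y ∈ L := by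
  rw [AddSubgroup.mem_map]
  constructor
  · rintro ⟨x, hx, rfl⟩
    exact (R_star_R hp x).symm ▸ hx
  · exact fun h => ⟨_, h, by simpa using R_star_R (star_ne_zero.2 hp) y⟩

theorem R_star_toRealQuat_mem_L_iff {p : icosianRing} {n : ℕ} (hn0 : n ≠ 0)
    (hn : (n : ℝ) = len (p * twist p)) {z : icosianRing} (hz : twist (z : ℍ[K]) = z) :
    R (star (p : ℍ[K])) (toRealQuat z) ∈ L ↔
      (n : icosianRing) ∣ star p * z * icosianTwistStar p := by
  have twist_eq : twist (star (p : ℍ[K]) * z * twist (star (p : ℍ[K]))) =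
      star (p : ℍ[K]) * z * twist (star (p : ℍ[K])) := by
    rw [twist_mul, twist_mul, twist_twist, hz, mul_assoc]
  rw [R_apply_toRealQuat, len_star_mul_twist_star, ← hn,
    inv_smul_toRealQuat_mem_L_iff hn0 twist_eq, ← leftDvd_coe_iff]
  rfl

theorem mem_csl_iff {p : icosianRing} {n : ℕ} (hn0 : n ≠ 0)
    (hn : (n : ℝ) = len (p * twist p)) {y : ℍ[ℝ]} :
    y ∈ csl p ↔ ∃ z : icosianRing, twist (z : ℍ[K]) = z ∧ toRealQuat z = y ∧
      (n : icosianRing) ∣ star p * z * icosianTwistStar p := by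
  have hp : (p : ℍ[K]) ≠ 0 := by
    intro h
    rw [h, zero_mul, len_eq_zero.2 rfl] at hn
    exact hn0 (Nat.cast_eq_zero.1 hn)
  rw [csl, AddSubgroup.mem_inf, mem_map_R_iff hp, ← map_fixedIcosians, AddSubgroup.mem_map,
    map_fixedIcosians]
  constructor
  · rintro ⟨⟨z, ⟨hz, tz⟩, rfl⟩, h⟩
    exact ⟨⟨z, hz⟩, tz, rfl, (R_star_toRealQuat_mem_L_iff (z := ⟨z, hz⟩) hn0 hn tz).1 h⟩
  · rintro ⟨z, tz, rfl, h⟩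
    exact ⟨⟨z, ⟨z.2, tz⟩, rfl⟩, (R_star_toRealQuat_mem_L_iff hn0 hn tz).2 h⟩

theorem csl_eq_of_span_op_pair_eq {p q : icosianRing} {n : ℕ} (hn0 : n ≠ 0)
    (hp : (n : ℝ) = len (p * twist p)) (hq : (n : ℝ) = len (q * twist q))
    (h : Submodule.span icosianRingᵐᵒᵖ {p, (n : icosianRing)} =
      Submodule.span icosianRingᵐᵒᵖ {q, (n : icosianRing)}) : csl p = csl q := by
  have p_mem : p ∈ Submodule.span icosianRingᵐᵒᵖ {q, (n : icosianRing)} :=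
    h ▸ Submodule.mem_span_of_mem (Set.mem_insert _ _)
  have q_mem : q ∈ Submodule.span icosianRingᵐᵒᵖ {p, (n : icosianRing)} :=
    h ▸ Submodule.mem_span_of_mem (Set.mem_insert _ _)
  ext y
  rw [mem_csl_iff hn0 hp, mem_csl_iff hn0 hq]
  exact exists_congr fun z => and_congr_right' <| and_congr_right'
    ⟨natCast_dvd_star_mul_mul_of_mem_span icosianTwistStar q_mem,
      natCast_dvd_star_mul_mul_of_mem_span icosianTwistStar p_mem⟩

end Lattice

end Icosian

end

theorem lemma3_general {p₁ p₂ : ℍ[Icosian.K]} (hp₁ : p₁ ∈ Icosian.𝕀) (hp₂ : p₂ ∈ Icosian.𝕀)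
    {n : ℕ} (hn0 : n ≠ 0) (hn₁ : (n : ℝ) = Icosian.len (p₁ * Icosian.twist p₁))
    (hn₂ : (n : ℝ) = Icosian.len (p₂ * Icosian.twist p₂))
    (hglcd : Icosian.glcd p₁ (n : ℍ[Icosian.K]) = Icosian.glcd p₂ (n : ℍ[Icosian.K])) :
    Icosian.csl p₁ = Icosian.csl p₂ := by
  lift p₁ to Icosian.icosianRing using hp₁
  lift p₂ to Icosian.icosianRing using hp₂
  exact Icosian.csl_eq_of_span_op_pair_eq hn0 hn₁ hn₂ (Icosian.span_op_pair_eq_of_glcd_eq hglcd)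

theorem lemma3 (p₁ p₂ : ℍ[Icosian.K])
    (hprim₁ : Icosian.IsPrimitive p₁) (hadm₁ : Icosian.IsAdmissible p₁)
    (hprim₂ : Icosian.IsPrimitive p₂) (hadm₂ : Icosian.IsAdmissible p₂)
    (n₁ n₂ : ℕ)
    (hn₁ : (n₁ : ℝ) = Icosian.len (p₁ * Icosian.twist p₁))
    (hn₂ : (n₂ : ℝ) = Icosian.len (p₂ * Icosian.twist p₂))
    (hnorm : Icosian.len p₁ ^ 2 = Icosian.len p₂ ^ 2)
    (hglcd : Icosian.glcd p₁ (n₁ : ℍ[Icosian.K]) = Icosian.glcd p₂ (n₂ : ℍ[Icosian.K])) :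
    Icosian.csl p₁ = Icosian.csl p₂ := by
  obtain rfl := Icosian.natCast_eq_of_len_eq hn₁ hn₂ hnorm
  refine lemma3_general hprim₁.1 hprim₂.1 (fun hn0 => ?_) hn₁ hn₂ hglcd
  exact Icosian.len_mul_twist_ne_zero hprim₁.ne_zero (hn₁ ▸ Nat.cast_eq_zero.2 hn0)
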